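/- Let $n,m$ be nonnegative integers, equip real matrix spaces with the Frobenius inner product $\langle X,Y\rangle=\mathrm{tr}(X^TY)$ and norm $\|\cdot\|_F$, and let $\mathbb S^n$ be the space of real symmetric $n\times n$ matrices, with $\mathbb S^n_+$, $\mathbb S^n_{-}$, $\mathbb S^n_{++}$ its positive semidefinite, negative semidefinite and positive definite elements. For a subset $S$ of a matrix space put $\sigma_S(x)=\sup_{v\in S}\langle v,x\rangle$, $\gamma_S(x)=\inf\{t\ge 0: x\in tS\}$, $S^\circ=\{v:\langle v,x\rangle\le 1\ (x\in S)\}$, and let $\delta_S$ be $0$ on $S$ and $+\infty$ off $S$; these functions take values in $[-\infty,+\infty]$, with $\inf\emptyset=+\infty$ and $(+\infty)^2=+\infty$. The conjugate of $f$ is $f^*(x)=\sup_y\{\langle y,x\rangle-f(y)\}$. Let $\mathrm{rge}$ denote the range of a matrix and $V^\dagger$ the Moore–Penrose pseudoinverse of $V$. Let $\mathcal V\subset\mathbb S^n$ be closed and convex, put $\mathrm{bar}\,\mathcal V=\{W\in\mathbb S^n:\sigma_{\mathcal V}(W)<+\infty\}$, and define $$\Phi_{\mathcal V}:\mathbb R^{n\times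 m}\to[-\infty,+\infty],\qquad \Phi_{\mathcal V}(Y)=\tfrac12\,\sigma_{\mathcal V\cap\mathbb S^n_+}(YY^T).$$ Consider the assumptions (i) $\mathcal V\cap\mathbb S^n_{++}\ne\emptyset$; (ii) $\mathcal V\cap\mathbb S^n_+$ is nonempty and bounded. If $\mathcal V\cap\mathbb S^n_+\neq\emptyset$, then $\mathcal V\cap\mathbb S^n_+$ is bounded if and only if $\mathbb S^n_-+\mathrm{bar}\,\mathcal V=\mathbb S^n$. Let (i) or (ii) hold. Then for every $X\in\mathbb R^{n\times m}$ $$\Phi_{\mathcal V}^*(X)=\inf_{V\in\mathbb S^n}\bigl\{\sigma_{\Omega(0,0)}(X,V)+\delta_{\mathcal V}(V)\bigr\}=\tfrac12\inf\bigl\{\mathrm{tr}(X^TV^\dagger X): V\in\mathcal V\cap\mathbb S^n_+,\ \mathrm{rge}\,X\subset\mathrm{rge}\,V\bigr\},$$ where $\Omega(0,0)=\{(Y,W)\in\mathbb R^{n\times m}\times\mathbb S^n:\tfrac12YY^T+W\in\mathbb S^n_-\}$ is the case $A=0$, $B=0$ of $$\Omega(A,B)=\{(Y,W)\in\mathbb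 R^{n\times m}\times\mathbb S^n: AY=B,\ \tfrac12YY^T+W\in\mathcal K_A^\circ\},\qquad \mathcal K_A=\{V\in\mathbb S^n:u^TVu\ge0\ (u\in\ker A)\},$$ for $A\in\mathbb R^{\ell\times n}$, $B\in\mathbb R^{\ell\times m}$, the polar $\mathcal K_A^\circ$ being taken in $\mathbb S^n$, and where $\sigma_{\Omega(0,0)}(X,V)=\sup_{(Y,W)\in\Omega(0,0)}\{\langle Y,X\rangle+\langle W,V\rangle\}$. If in addition $0\in\mathcal V$, then $$\Phi_{\mathcal V}=\tfrac12\gamma_{\mathcal F^\circ}^2\quad\text{and}\quad \Phi_{\mathcal V}^*=\tfrac12\gamma_{\mathcal F}^2,\qquad \mathcal F=\{LZ: L\in\mathbb R^{n\times n},\ LL^T\in\mathcal V\cap\mathbb S^n_+,\ Z\in\mathbb R^{n\times m},\ \|Z\|_F\le1\}.$$ Moreover, under (i) $\Phi_{\mathcal V}^*$ is finite-valued, and under (ii) $\Phi_{\mathcal V}$ is finite-valued. -/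

import Mathlib

open Matrix
open scoped Pointwise

noncomputable section

namespace VGF

/-- The Frobenius inner product `⟨X, Y⟩ = tr(Xᵀ Y)` on real `n × m` matrices. -/
def frobInner {n m : ℕ} (X Y : Matrix (Fin n) (Fin m) ℝ) : ℝ :=
  (Xᵀ * Y).trace

/-- The Frobenius norm. -/
def frobNorm {n m : ℕ} (X : Matrix (Fin n) (Fin m) ℝ) : ℝ :=
  Real.sqrt (frobInner X X)

/-- A set of matrices is bounded (in the Frobenius norm). -/
def FrobBounded {n m : ℕ} (S : Set (Matrix (Fin n) (Fin m) ℝ)) : Prop :=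
  ∃ C : ℝ, ∀ X ∈ S, frobNorm X ≤ C

/-- The symmetric `n × n` matrices. -/
def symMat (n : ℕ) : Set (Matrix (Fin n) (Fin n) ℝ) := {V | V.IsSymm}

/-- The positive semidefinite cone (its members are symmetric). -/
def psdCone (n : ℕ) : Set (Matrix (Fin n) (Fin n) ℝ) := {V | V.PosSemidef}

/-- The positive definite matrices (symmetric by definition). -/
def pdCone (n : ℕ) : Set (Matrix (Fin n) (Fin n) ℝ) := {V | V.PosDef}

/-- The negative semidefinite cone. -/
def nsdCone (n : ℕ) : Set (Matrix (Fin n) (Fin n) ℝ) := {V | (-V).PosSemidef}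

/-- The range of a matrix, as a linear map acting on column vectors. -/
def rge {n m : ℕ} (A : Matrix (Fin n) (Fin m) ℝ) : Submodule ℝ (Fin n → ℝ) :=
  LinearMap.range A.mulVecLin

/-- The support function `σ_S(X) = sup {⟨W, X⟩ : W ∈ S}`, with values in `[-∞, ∞]`. -/
def supportFn {n m : ℕ} (S : Set (Matrix (Fin n) (Fin m) ℝ))
    (X : Matrix (Fin n) (Fin m) ℝ) : EReal :=
  ⨆ W ∈ S, (frobInner W X : EReal)

/-- The support function of a set of pairs of matrices, for the inner product
`⟨(Y, W), (X, V)⟩ = tr(Yᵀ X) + tr(Wᵀ V)`. -/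
def supportFnProd {n m : ℕ} (S : Set (Matrix (Fin n) (Fin m) ℝ × Matrix (Fin n) (Fin n) ℝ))
    (X : Matrix (Fin n) (Fin m) ℝ) (V : Matrix (Fin n) (Fin n) ℝ) : EReal :=
  ⨆ P ∈ S, ((frobInner P.1 X + frobInner P.2 V : ℝ) : EReal)

open Classical in
/-- The indicator function of convex analysis: `0` on `S` and `+∞` off `S`. -/
def indicatorFn {E : Type*} (S : Set E) (x : E) : EReal := if x ∈ S then 0 else ⊤

/-- The gauge `γ_S(X) = inf {t ≥ 0 : X ∈ t S}`, where the infimum over the empty set is `+∞`. -/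
def gaugeFn {n m : ℕ} (S : Set (Matrix (Fin n) (Fin m) ℝ))
    (X : Matrix (Fin n) (Fin m) ℝ) : EReal :=
  ⨅ (t : ℝ) (_ : 0 ≤ t ∧ X ∈ t • S), (t : EReal)

/-- The polar set `S° = {Y : ⟨Y, X⟩ ≤ 1 for all X ∈ S}`. -/
def polarSet {n m : ℕ} (S : Set (Matrix (Fin n) (Fin m) ℝ)) :
    Set (Matrix (Fin n) (Fin m) ℝ) :=
  {Y | ∀ X ∈ S, frobInner Y X ≤ 1}

/-- The barrier cone, i.e. the domain of the support function, of a set of symmetric matrices,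
taken in the space of symmetric matrices. -/
def barrierCone {n : ℕ} (S : Set (Matrix (Fin n) (Fin n) ℝ)) :
    Set (Matrix (Fin n) (Fin n) ℝ) :=
  {W | W ∈ symMat n ∧ supportFn S W < ⊤}

/-- The Fenchel conjugate `f*(X) = sup_Y (⟨Y, X⟩ - f(Y))`. -/
def conjFn {n m : ℕ} (f : Matrix (Fin n) (Fin m) ℝ → EReal)
    (X : Matrix (Fin n) (Fin m) ℝ) : EReal :=
  ⨆ Y, ((frobInner Y X : EReal) - f Y)

/-- The variational Gram function `Φ_V(Y) = ½ σ_{V ∩ S₊}(Y Yᵀ)`. -/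
def gramFn {n : ℕ} (m : ℕ) (V : Set (Matrix (Fin n) (Fin n) ℝ))
    (Y : Matrix (Fin n) (Fin m) ℝ) : EReal :=
  ((1 / 2 : ℝ) : EReal) * supportFn (V ∩ psdCone n) (Y * Yᵀ)

/-- The cone `K_A` of symmetric matrices that are positive semidefinite on `ker A`. -/
def coneK {l n : ℕ} (A : Matrix (Fin l) (Fin n) ℝ) : Set (Matrix (Fin n) (Fin n) ℝ) :=
  {V | V ∈ symMat n ∧ ∀ u : Fin n → ℝ, A *ᵥ u = 0 → 0 ≤ u ⬝ᵥ (V *ᵥ u)}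

/-- `Ω(A, B) = {(Y, W) : A Y = B, ½ Y Yᵀ + W ∈ K_A°}`, the polar cone being taken in the space of
symmetric matrices. -/
def setOmega {l n m : ℕ} (A : Matrix (Fin l) (Fin n) ℝ) (B : Matrix (Fin l) (Fin m) ℝ) :
    Set (Matrix (Fin n) (Fin m) ℝ × Matrix (Fin n) (Fin n) ℝ) :=
  {P | P.2 ∈ symMat n ∧ A * P.1 = B ∧
    (1 / 2 : ℝ) • (P.1 * P.1ᵀ) + P.2 ∈ polarSet (coneK A) ∩ symMat n}

/-- `F = {L Z : L ∈ ℝⁿˣⁿ, L Lᵀ ∈ V ∩ S₊, Z ∈ ℝⁿˣᵐ, ‖Z‖_F ≤ 1}`. -/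
def factorSet {n : ℕ} (m : ℕ) (V : Set (Matrix (Fin n) (Fin n) ℝ)) :
    Set (Matrix (Fin n) (Fin m) ℝ) :=
  {X | ∃ (L : Matrix (Fin n) (Fin n) ℝ) (Z : Matrix (Fin n) (Fin m) ℝ),
    L * Lᵀ ∈ V ∩ psdCone n ∧ frobNorm Z ≤ 1 ∧ X = L * Z}

/-- The four Penrose conditions: `B` is a Moore–Penrose pseudoinverse of `A`. -/
structure IsMoorePenrose {k n : ℕ} (A : Matrix (Fin k) (Fin n) ℝ)
    (B : Matrix (Fin n) (Fin k) ℝ) : Prop where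
  mul_mul_left : A * B * A = A
  mul_mul_right : B * A * B = B
  symm_left : (A * B)ᵀ = A * B
  symm_right : (B * A)ᵀ = B * A

theorem IsMoorePenrose.unique {k n : ℕ} {A : Matrix (Fin k) (Fin n) ℝ}
    {B C : Matrix (Fin n) (Fin k) ℝ} (hB : IsMoorePenrose A B) (hC : IsMoorePenrose A C) :
    B = C := by
  have e1 : A * B = A * C := by
    calc A * B = (A * B)ᵀ := hB.symm_left.symm
      _ = (A * C * A * B)ᵀ := by rw [hC.mul_mul_left]
      _ = (A * B)ᵀ * (A * C)ᵀ := by rw [← transpose_mul]; simp only [Matrix.mul_assoc]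
      _ = A * B * (A * C) := by rw [hB.symm_left, hC.symm_left]
      _ = A * C := by rw [← Matrix.mul_assoc, hB.mul_mul_left]
  have e2 : B * A = C * A := by
    calc B * A = (B * A)ᵀ := hB.symm_right.symm
      _ = (B * (A * C * A))ᵀ := by rw [hC.mul_mul_left]
      _ = (C * A)ᵀ * (B * A)ᵀ := by rw [← transpose_mul]; simp only [Matrix.mul_assoc]
      _ = C * A * (B * A) := by rw [hB.symm_right, hC.symm_right]
      _ = C * (A * B * A) := by simp only [Matrix.mul_assoc]
      _ = C * A := by rw [hB.mul_mul_left]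
  calc B = B * A * B := hB.mul_mul_right.symm
    _ = C * A * B := by rw [e2]
    _ = C * (A * B) := Matrix.mul_assoc _ _ _
    _ = C * (A * C) := by rw [e1]
    _ = C * A * C := (Matrix.mul_assoc _ _ _).symm
    _ = C := hC.mul_mul_right

theorem exists_symm_pinv {n : ℕ} (H : Matrix (Fin n) (Fin n) ℝ) (hH : H.IsHermitian) :
    ∃ G : Matrix (Fin n) (Fin n) ℝ, H * G * H = H ∧ G * H * G = G ∧ Gᵀ = G ∧ G * H = H * G := by
  obtain ⟨U, d, hU, rfl⟩ : ∃ (U : Matrix (Fin n) (Fin n) ℝ) (d : Fin n → ℝ),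
      Uᵀ * U = 1 ∧ H = U * diagonal d * Uᵀ := by
    refine ⟨hH.eigenvectorUnitary, hH.eigenvalues, ?_, ?_⟩
    · have := Unitary.coe_star_mul_self hH.eigenvectorUnitary
      simpa [star_eq_conjTranspose] using this
    · have := hH.spectral_theorem
      simpa [Unitary.conjStarAlgAut_apply, star_eq_conjTranspose, Function.comp_def] using this
  have key : ∀ a b : Fin n → ℝ, U * diagonal a * Uᵀ * (U * diagonal b * Uᵀ) =
      U * diagonal (fun i => a i * b i) * Uᵀ := by
    intro a b
    calc U * diagonal a * Uᵀ * (U * diagonal b * Uᵀ)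
        = U * diagonal a * (Uᵀ * U) * diagonal b * Uᵀ := by simp only [Matrix.mul_assoc]
      _ = U * (diagonal a * diagonal b) * Uᵀ := by
          rw [hU, Matrix.mul_one]; simp only [Matrix.mul_assoc]
      _ = _ := by rw [diagonal_mul_diagonal]
  refine ⟨U * diagonal (fun i => (d i)⁻¹) * Uᵀ, ?_, ?_, ?_, ?_⟩
  · rw [key, key]
    have e : (fun i => d i * (d i)⁻¹ * d i) = d := by
      funext i
      by_cases h : d i = 0 <;> simp [h]
    rw [e]
  · rw [key, key]
    have e : (fun i => (d i)⁻¹ * d i * (d i)⁻¹) = fun i => (d i)⁻¹ := by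
      funext i
      by_cases h : d i = 0 <;> simp [h]
    rw [e]
  · simp [Matrix.mul_assoc]
  · simp only [key, mul_comm]

theorem exists_isMoorePenrose {k n : ℕ} (A : Matrix (Fin k) (Fin n) ℝ) :
    ∃ B, IsMoorePenrose A B := by
  obtain ⟨G, h1, h2, h3, h4⟩ := exists_symm_pinv (Aᵀ * A)
    (by simpa using isHermitian_conjTranspose_mul_self A)
  have h0 : A * (G * (Aᵀ * A)) - A = 0 := by
    apply conjTranspose_mul_self_eq_zero.1
    have : Aᵀ * (A * (G * (Aᵀ * A)) - A) = 0 := by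
      rw [Matrix.mul_sub, sub_eq_zero]
      simpa only [Matrix.mul_assoc] using h1
    calc (A * (G * (Aᵀ * A)) - A)ᴴ * (A * (G * (Aᵀ * A)) - A)
        = (G * (Aᵀ * A) - 1)ᵀ * (Aᵀ * (A * (G * (Aᵀ * A)) - A)) := by
          have e : A * (G * (Aᵀ * A)) - A = A * (G * (Aᵀ * A) - 1) := by
            rw [Matrix.mul_sub, Matrix.mul_one]
          rw [conjTranspose_eq_transpose_of_trivial]
          nth_rewrite 1 [e]
          rw [transpose_mul, Matrix.mul_assoc]
      _ = 0 := by rw [this, Matrix.mul_zero]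
  refine ⟨G * Aᵀ, ?_, ?_, ?_, ?_⟩
  · simpa only [Matrix.mul_assoc] using sub_eq_zero.1 h0
  · calc G * Aᵀ * A * (G * Aᵀ) = G * (Aᵀ * A) * G * Aᵀ := by simp only [Matrix.mul_assoc]
      _ = G * Aᵀ := by rw [h2]
  · simp [h3, Matrix.mul_assoc]
  · rw [Matrix.mul_assoc, transpose_mul, h3, transpose_mul, transpose_transpose, h4]

/-- The Moore–Penrose pseudoinverse. -/
def pinv {k n : ℕ} (A : Matrix (Fin k) (Fin n) ℝ) : Matrix (Fin n) (Fin k) ℝ :=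
  (exists_isMoorePenrose A).choose

theorem pinv_spec {k n : ℕ} (A : Matrix (Fin k) (Fin n) ℝ) : IsMoorePenrose A (pinv A) :=
  (exists_isMoorePenrose A).choose_spec

end VGF

end

/-! The proof rests on the coupling ⟨Y, X⟩ - ½⟨W, YYᵀ⟩, affine in W and, for W ⪰ 0, concave in Y.
Its infimum over W ∈ V ∩ S₊ is ⟨Y, X⟩ - Φ(Y), so Φ* is a sup-inf. Its supremum over Y is, by
completing the square, ½ tr(XᵀW†X) if rge X ⊂ rge W and +∞ otherwise; it is also σ_Ω(X, W). Both
formulas for Φ* thus amount to exchanging inf and sup. Under (ii) this is Sion's theorem on the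
compact set V ∩ S₊ (`minimax_of_isCompact`). Under (i) a positive definite W₀ has compact superlevel
sets in Y, which reduces the exchange to the hull of finitely many W (`minimax_of_posDef`).

The gauges come from factoring W = LLᵀ: writing X = LZ costs ½‖Z‖², while the supremum of ⟨Y, LZ⟩
over ‖Z‖ ≤ 1 is ‖LᵀY‖, whose square is ⟨W, YYᵀ⟩.

The boundedness criterion is a separation argument: a functional nonpositive on S₋ + bar V is given
by a positive semidefinite recession direction of V, which boundedness forces to vanish. Conversely,
splitting the identity matrix bounds the trace on V ∩ S₊. -/

/-- A convex cone of a finite-dimensional space that is contained in no half-space is the whole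
space. -/
theorem eq_univ_of_forall_linear_nonpos {E : Type*} [NormedAddCommGroup E] [NormedSpace ℝ E]
    [FiniteDimensional ℝ E] {C : Set E} (h0 : (0 : E) ∈ C) (hC : Convex ℝ C)
    (hsmul : ∀ t : ℝ, 0 ≤ t → ∀ x ∈ C, t • x ∈ C)
    (hf : ∀ f : E →ₗ[ℝ] ℝ, (∀ x ∈ C, f x ≤ 0) → f = 0) : C = Set.univ := by
  by_contra hne
  obtain ⟨x, hx⟩ := (Set.ne_univ_iff_exists_notMem C).1 hne
  by_cases hint : (interior C).Nonempty
  -- `C` need not be closed: with interior points it can still be separated from `x`, and otherwise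
  -- it spans a proper subspace, which some nonzero functional annihilates.
  · obtain ⟨f, hf0, hfx⟩ := geometric_hahn_banach_of_nonempty_interior_point hC
      (fun h => hx (interior_subset h)) hint
    apply hf0
    have := hf f.toLinearMap fun a ha => by
      by_contra! hpos
      have hpos' : 0 < f a := hpos
      have h0x : 0 ≤ f x := by simpa using hfx 0 h0
      -- This multiple of `a` has value `f x + 1`, above the bound `f x` on the cone.
      have h1 := hfx _ (hsmul ((f x + 1) / f a) (by positivity) a ha)
      rw [map_smul, smul_eq_mul, div_mul_cancel₀ _ hpos'.ne'] at h1
      linarith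
    ext y
    exact LinearMap.congr_fun this y
  · rw [hC.interior_nonempty_iff_affineSpan_eq_top] at hint
    have hspan : Submodule.span ℝ C < ⊤ := by
      rw [lt_top_iff_ne_top]
      intro h
      apply hint
      rw [← AffineSubspace.direction_eq_top_iff_of_nonempty
        (⟨0, subset_affineSpan ℝ C h0⟩ : (affineSpan ℝ C : Set E).Nonempty),
        direction_affineSpan, eq_top_iff, ← h, Submodule.span_le]
      intro y hy
      simpa using vsub_mem_vectorSpan ℝ hy h0
    obtain ⟨f, hf0, hfC⟩ := Submodule.exists_le_ker_of_lt_top _ hspan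
    exact hf0 (hf f fun y hy => le_of_eq (hfC (Submodule.subset_span hy)))

namespace VGF

variable {n m : ℕ}

/-! ### The Frobenius inner product. -/

theorem frobInner_eq_sum (X Y : Matrix (Fin n) (Fin m) ℝ) :
    frobInner X Y = ∑ i, ∑ j, X i j * Y i j := by
  simp only [frobInner, Matrix.trace, Matrix.diag, Matrix.mul_apply, Matrix.transpose_apply]
  exact Finset.sum_comm

theorem frobInner_comm (X Y : Matrix (Fin n) (Fin m) ℝ) : frobInner X Y = frobInner Y X := by
  simp only [frobInner_eq_sum, mul_comm]

theorem frobInner_add_left (X Y Z : Matrix (Fin n) (Fin m) ℝ) :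
    frobInner (X + Y) Z = frobInner X Z + frobInner Y Z := by
  simp [frobInner, Matrix.add_mul]

theorem frobInner_add_right (X Y Z : Matrix (Fin n) (Fin m) ℝ) :
    frobInner X (Y + Z) = frobInner X Y + frobInner X Z := by
  simp [frobInner, Matrix.mul_add]

theorem frobInner_sub_left (X Y Z : Matrix (Fin n) (Fin m) ℝ) :
    frobInner (X - Y) Z = frobInner X Z - frobInner Y Z := by
  simp [frobInner, Matrix.sub_mul]

theorem frobInner_sub_right (X Y Z : Matrix (Fin n) (Fin m) ℝ) :
    frobInner X (Y - Z) = frobInner X Y - frobInner X Z := by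
  simp [frobInner, Matrix.mul_sub]

theorem frobInner_neg_left (X Y : Matrix (Fin n) (Fin m) ℝ) :
    frobInner (-X) Y = -frobInner X Y := by
  simp [frobInner]

theorem frobInner_neg_right (X Y : Matrix (Fin n) (Fin m) ℝ) :
    frobInner X (-Y) = -frobInner X Y := by
  simp [frobInner]

theorem frobInner_smul_left (t : ℝ) (X Y : Matrix (Fin n) (Fin m) ℝ) :
    frobInner (t • X) Y = t * frobInner X Y := by
  simp [frobInner]

theorem frobInner_smul_right (t : ℝ) (X Y : Matrix (Fin n) (Fin m) ℝ) :
    frobInner X (t • Y) = t * frobInner X Y := by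
  simp [frobInner]

theorem frobInner_zero_left (X : Matrix (Fin n) (Fin m) ℝ) : frobInner 0 X = 0 := by
  simp [frobInner]

theorem frobInner_zero_right (X : Matrix (Fin n) (Fin m) ℝ) : frobInner X 0 = 0 := by
  simp [frobInner]

theorem frobInner_transpose (X Y : Matrix (Fin n) (Fin m) ℝ) :
    frobInner Xᵀ Yᵀ = frobInner X Y := by
  simp only [frobInner_eq_sum, Matrix.transpose_apply]
  exact Finset.sum_comm

theorem frobInner_self_nonneg (X : Matrix (Fin n) (Fin m) ℝ) : 0 ≤ frobInner X X := by
  rw [frobInner_eq_sum]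
  exact Finset.sum_nonneg fun i _ => Finset.sum_nonneg fun j _ => mul_self_nonneg _

theorem frobInner_self_eq_zero {X : Matrix (Fin n) (Fin m) ℝ} : frobInner X X = 0 ↔ X = 0 := by
  simpa [frobInner] using trace_conjTranspose_mul_self_eq_zero_iff (A := X)

theorem abs_apply_le_frobNorm (X : Matrix (Fin n) (Fin m) ℝ) (i : Fin n) (j : Fin m) :
    |X i j| ≤ frobNorm X := by
  apply Real.abs_le_sqrt
  rw [frobInner_eq_sum, sq]
  exact (Finset.single_le_sum (f := fun j => X i j * X i j) (fun j _ => mul_self_nonneg _)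
    (Finset.mem_univ j)).trans (Finset.single_le_sum (f := fun i => ∑ j, X i j * X i j)
    (fun i _ => Finset.sum_nonneg fun j _ => mul_self_nonneg _) (Finset.mem_univ i))

theorem frobInner_le_of_frobNorm_le {X : Matrix (Fin n) (Fin m) ℝ} {c : ℝ}
    (h : frobNorm X ≤ c) : frobInner X X ≤ c ^ 2 :=
  (Real.sqrt_le_iff.1 h).2

theorem continuous_frobInner {T : Type*} [TopologicalSpace T]
    {f g : T → Matrix (Fin n) (Fin m) ℝ} (hf : Continuous f) (hg : Continuous g) :
    Continuous fun x => frobInner (f x) (g x) :=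
  (hf.matrix_transpose.matrix_mul hg).matrix_trace

/-- Heine–Borel for matrix spaces. -/
theorem isCompact_of_frobBounded {S : Set (Matrix (Fin n) (Fin m) ℝ)} (hS : IsClosed S)
    (hb : FrobBounded S) : IsCompact S := by
  obtain ⟨C, hC⟩ := hb
  have hK : IsCompact (Set.pi Set.univ fun _ : Fin n => Set.pi Set.univ fun _ : Fin m =>
      Set.Icc (-C) C) :=
    isCompact_univ_pi fun _ => isCompact_univ_pi fun _ => isCompact_Icc
  refine IsCompact.of_isClosed_subset (X := Matrix (Fin n) (Fin m) ℝ) hK hS fun X hX i _ j _ => ?_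
  exact abs_le.1 ((abs_apply_le_frobNorm X i j).trans (hC X hX))

theorem isCompact_frobInner_sub_le (Z : Matrix (Fin n) (Fin m) ℝ) (R : ℝ) :
    IsCompact {M : Matrix (Fin n) (Fin m) ℝ | frobInner (M - Z) (M - Z) ≤ R} := by
  refine isCompact_of_frobBounded (isClosed_le (continuous_frobInner (by fun_prop) (by fun_prop))
    continuous_const) ⟨Real.sqrt (2 * R + 2 * frobInner Z Z), fun M hM => Real.sqrt_le_sqrt ?_⟩
  -- ‖M - 2Z‖² = 2‖M - Z‖² + 2‖Z‖² - ‖M‖², which yields the chosen radius.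
  have h := frobInner_self_nonneg (M - (2 : ℝ) • Z)
  have hM' : frobInner (M - Z) (M - Z) ≤ R := hM
  simp only [frobInner_sub_left, frobInner_sub_right, frobInner_smul_left, frobInner_smul_right,
    frobInner_comm Z M] at h hM'
  linarith

/-- Every linear functional is a Frobenius inner product. -/
theorem exists_frobInner_eq (f : Matrix (Fin n) (Fin m) ℝ →ₗ[ℝ] ℝ) :
    ∃ H : Matrix (Fin n) (Fin m) ℝ, ∀ X, f X = frobInner H X := by
  refine ⟨Matrix.of fun i j => f (Matrix.single i j 1), fun X => ?_⟩
  conv_lhs => rw [matrix_eq_sum_single X]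
  rw [frobInner_eq_sum]
  simp only [map_sum, Matrix.of_apply]
  refine Finset.sum_congr rfl fun i _ => Finset.sum_congr rfl fun j _ => ?_
  rw [mul_comm, ← smul_eq_mul, ← map_smul, Matrix.smul_single, smul_eq_mul, mul_one]

theorem frobInner_mul_transpose (L : Matrix (Fin n) (Fin n) ℝ) (Y : Matrix (Fin n) (Fin m) ℝ) :
    frobInner (L * Lᵀ) (Y * Yᵀ) = frobInner (Lᵀ * Y) (Lᵀ * Y) := by
  simp only [frobInner, transpose_mul, transpose_transpose]
  rw [← Matrix.mul_assoc, trace_mul_comm]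
  simp only [Matrix.mul_assoc]

theorem frobInner_mul_left (A : Matrix (Fin n) (Fin n) ℝ) (X Y : Matrix (Fin n) (Fin m) ℝ) :
    frobInner (A * X) Y = frobInner X (Aᵀ * Y) := by
  simp only [frobInner, transpose_mul, Matrix.mul_assoc]

theorem frobInner_mul_right (A : Matrix (Fin n) (Fin n) ℝ) (X Y : Matrix (Fin n) (Fin m) ℝ) :
    frobInner X (A * Y) = frobInner (Aᵀ * X) Y := by
  rw [frobInner_mul_left, transpose_transpose]

theorem frobInner_mul_transpose_eq (W : Matrix (Fin n) (Fin n) ℝ)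
    (Y : Matrix (Fin n) (Fin m) ℝ) : frobInner W (Y * Yᵀ) = frobInner (W * Y) Y := by
  simp only [frobInner, transpose_mul]
  rw [← Matrix.mul_assoc, trace_mul_comm]
  simp only [Matrix.mul_assoc]

theorem frobInner_vecMulVec (W : Matrix (Fin n) (Fin n) ℝ) (u : Fin n → ℝ) :
    frobInner W (vecMulVec u u) = u ⬝ᵥ (W *ᵥ u) := by
  simp only [frobInner_eq_sum, dotProduct, mulVec, vecMulVec_apply, Finset.mul_sum]
  exact Finset.sum_congr rfl fun i _ => Finset.sum_congr rfl fun j _ => by ring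

/-! ### The positive semidefinite cone. -/

theorem isSymm_of_posSemidef {W : Matrix (Fin n) (Fin n) ℝ} (hW : W.PosSemidef) : W.IsSymm := by
  simpa [IsHermitian, IsSymm] using hW.1

theorem posSemidef_iff_frobInner {W : Matrix (Fin n) (Fin n) ℝ} :
    W.PosSemidef ↔ W.IsSymm ∧ ∀ u, 0 ≤ frobInner W (vecMulVec u u) := by
  simp [posSemidef_iff_dotProduct_mulVec, frobInner_vecMulVec, IsHermitian, IsSymm]

theorem posSemidef_vecMulVec (u : Fin n → ℝ) : (vecMulVec u u).PosSemidef := by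
  simpa using posSemidef_vecMulVec_self_star u

theorem posSemidef_mul_transpose (Y : Matrix (Fin n) (Fin m) ℝ) : (Y * Yᵀ).PosSemidef := by
  simpa using posSemidef_self_mul_conjTranspose Y

theorem exists_eq_mul_transpose {W : Matrix (Fin n) (Fin n) ℝ} (hW : W.PosSemidef) :
    ∃ L : Matrix (Fin n) (Fin n) ℝ, W = L * Lᵀ := by
  open scoped MatrixOrder in
  obtain ⟨B, hB⟩ := CStarAlgebra.nonneg_iff_eq_star_mul_self.1 hW.nonneg
  exact ⟨Bᵀ, by simpa [star_eq_conjTranspose] using hB⟩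

theorem frobInner_nonneg_of_posSemidef {P Q : Matrix (Fin n) (Fin n) ℝ} (hP : P.PosSemidef)
    (hQ : Q.PosSemidef) : 0 ≤ frobInner P Q := by
  obtain ⟨L, rfl⟩ := exists_eq_mul_transpose hP
  obtain ⟨R, rfl⟩ := exists_eq_mul_transpose hQ
  rw [frobInner_mul_transpose]
  exact frobInner_self_nonneg _

theorem isClosed_psdCone : IsClosed (psdCone n) := by
  have : psdCone n = {W | Wᵀ = W} ∩ ⋂ u, {W | 0 ≤ frobInner W (vecMulVec u u)} := by
    ext W
    simp only [psdCone, Set.mem_ofPred_eq, posSemidef_iff_frobInner, Set.mem_inter_iff,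
      Set.mem_iInter, IsSymm]
  rw [this]
  exact (isClosed_eq (by fun_prop) continuous_id).inter (isClosed_iInter fun u =>
    isClosed_le continuous_const (continuous_frobInner continuous_id continuous_const))

theorem convex_psdCone : Convex ℝ (psdCone n) := fun _ hP _ hQ _ _ ha hb _ =>
  (hP.smul ha).add (hQ.smul hb)

/-- For W = LLᵀ the entries are inner products of rows of L; Cauchy–Schwarz on each entry and
summation give ‖W‖² ≤ (tr W)². -/
theorem frobNorm_le_trace {W : Matrix (Fin n) (Fin n) ℝ} (hW : W.PosSemidef) :
    frobNorm W ≤ frobInner W 1 := by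
  have htr : 0 ≤ frobInner W 1 := frobInner_nonneg_of_posSemidef hW PosSemidef.one
  obtain ⟨L, rfl⟩ := exists_eq_mul_transpose hW
  refine Real.sqrt_le_iff.2 ⟨htr, ?_⟩
  have h1 : frobInner (L * Lᵀ) 1 = ∑ i, ∑ k, L i k ^ 2 := by
    simp [frobInner, Matrix.trace, Matrix.mul_apply, sq]
  rw [h1, sq, Finset.sum_mul_sum, frobInner_eq_sum]
  refine Finset.sum_le_sum fun i _ => Finset.sum_le_sum fun j _ => ?_
  rw [← sq, Matrix.mul_apply]
  exact Finset.sum_mul_sq_le_sq_mul_sq _ _ _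

/-! ### Pseudoinverse and range. -/

theorem transpose_pinv {W : Matrix (Fin n) (Fin n) ℝ} (hW : W.IsSymm) : (pinv W)ᵀ = pinv W := by
  have h := pinv_spec W
  refine IsMoorePenrose.unique (A := W) ⟨?_, ?_, ?_, ?_⟩ h
  · simpa [hW.eq, Matrix.mul_assoc] using congrArg Matrix.transpose h.mul_mul_left
  · simpa [hW.eq, Matrix.mul_assoc] using congrArg Matrix.transpose h.mul_mul_right
  · have := h.symm_right
    rw [transpose_mul, hW.eq] at this
    rw [this, transpose_mul, hW.eq, this]
  · have := h.symm_left
    rw [transpose_mul, hW.eq] at this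
    rw [this, transpose_mul, hW.eq, this]

theorem rge_le_iff (W : Matrix (Fin n) (Fin n) ℝ) (X : Matrix (Fin n) (Fin m) ℝ) :
    rge X ≤ rge W ↔ W * pinv W * X = X := by
  constructor
  · intro h
    ext i j
    obtain ⟨v, hv⟩ := h (LinearMap.mem_range_self X.mulVecLin (Pi.single j 1))
    simp only [mulVecLin_apply, mulVec_single_one] at hv
    have h2 : (W * pinv W * X) *ᵥ Pi.single j 1 = X *ᵥ Pi.single j 1 := by
      rw [← mulVec_mulVec, mulVec_single_one, ← hv, mulVec_mulVec, (pinv_spec W).mul_mul_left]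
    simpa [mulVec_single_one] using congrFun h2 i
  · rintro h _ ⟨v, rfl⟩
    refine ⟨(pinv W * X) *ᵥ v, ?_⟩
    simp only [mulVecLin_apply, mulVec_mulVec, ← Matrix.mul_assoc, h]

/-! ### The coupling and its supremum in Y. -/

/-- The concave-convex coupling `⟨Y, X⟩ - ½ ⟨W, Y Yᵀ⟩`. -/
noncomputable def coupling (X : Matrix (Fin n) (Fin m) ℝ) (W : Matrix (Fin n) (Fin n) ℝ)
    (Y : Matrix (Fin n) (Fin m) ℝ) : ℝ :=
  frobInner Y X - 1 / 2 * frobInner W (Y * Yᵀ)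

theorem coupling_zero (X : Matrix (Fin n) (Fin m) ℝ) (W : Matrix (Fin n) (Fin n) ℝ) :
    coupling X W 0 = 0 := by
  simp [coupling, frobInner_zero_left, frobInner_zero_right]

/-- Completing the square: the right side minus the left is ½‖LᵀY - Z‖². -/
theorem coupling_mul_le (L : Matrix (Fin n) (Fin n) ℝ) (Z Y : Matrix (Fin n) (Fin m) ℝ) :
    coupling (L * Z) (L * Lᵀ) Y ≤ 1 / 2 * frobInner Z Z := by
  have h := frobInner_self_nonneg (Lᵀ * Y - Z)
  rw [coupling, frobInner_mul_transpose, frobInner_mul_right]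
  simp only [frobInner_sub_left, frobInner_sub_right, frobInner_comm Z (Lᵀ * Y)] at h
  linarith

theorem trace_eq_frobInner (W : Matrix (Fin n) (Fin n) ℝ) (X : Matrix (Fin n) (Fin m) ℝ) :
    (Xᵀ * pinv W * X).trace = frobInner X (pinv W * X) := by
  rw [frobInner, Matrix.mul_assoc]

/-- A point of the range of `L Lᵀ` factors through `L` with squared norm `tr (Xᵀ (L Lᵀ)† X)`. -/
theorem factor_of_rge_le (L : Matrix (Fin n) (Fin n) ℝ) (X : Matrix (Fin n) (Fin m) ℝ)
    (h : rge X ≤ rge (L * Lᵀ)) :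
    L * (Lᵀ * pinv (L * Lᵀ) * X) = X ∧
      frobInner (Lᵀ * pinv (L * Lᵀ) * X) (Lᵀ * pinv (L * Lᵀ) * X) =
        (Xᵀ * pinv (L * Lᵀ) * X).trace := by
  rw [rge_le_iff] at h
  refine ⟨by simpa only [Matrix.mul_assoc] using h, ?_⟩
  have hs := transpose_pinv (isSymm_of_posSemidef (posSemidef_mul_transpose L))
  rw [trace_eq_frobInner, Matrix.mul_assoc, frobInner_mul_right, transpose_transpose,
    ← Matrix.mul_assoc, ← Matrix.mul_assoc, h]

theorem coupling_le_trace {W : Matrix (Fin n) (Fin n) ℝ} (hW : W.PosSemidef)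
    {X : Matrix (Fin n) (Fin m) ℝ} (h : rge X ≤ rge W) (Y : Matrix (Fin n) (Fin m) ℝ) :
    coupling X W Y ≤ 1 / 2 * (Xᵀ * pinv W * X).trace := by
  obtain ⟨L, rfl⟩ := exists_eq_mul_transpose hW
  obtain ⟨h1, h2⟩ := factor_of_rge_le L X h
  have := coupling_mul_le L (Lᵀ * pinv (L * Lᵀ) * X) Y
  rwa [h1, h2] at this

theorem coupling_pinv {W : Matrix (Fin n) (Fin n) ℝ}
    {X : Matrix (Fin n) (Fin m) ℝ} (h : rge X ≤ rge W) :
    coupling X W (pinv W * X) = 1 / 2 * (Xᵀ * pinv W * X).trace := by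
  rw [rge_le_iff] at h
  rw [coupling, frobInner_mul_transpose_eq, ← Matrix.mul_assoc, h, trace_eq_frobInner,
    frobInner_comm (pinv W * X)]
  ring

/-- Along the component P of X orthogonal to rge W the quadratic term vanishes, so the coupling
grows linearly with slope ‖P‖²; an upper bound forces P = 0. -/
theorem rge_le_of_coupling_le {W : Matrix (Fin n) (Fin n) ℝ} (hW : W.IsSymm)
    {X : Matrix (Fin n) (Fin m) ℝ} {c : ℝ} (h : ∀ Y, coupling X W Y ≤ c) : rge X ≤ rge W := by
  have hp := pinv_spec W
  have hcomm : pinv W * W = W * pinv W := by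
    rw [← hp.symm_right, transpose_mul, hW.eq, transpose_pinv hW]
  set P := X - W * pinv W * X with hP
  have hWP : W * P = 0 := by
    rw [hP, Matrix.mul_sub, ← Matrix.mul_assoc, ← hcomm, ← Matrix.mul_assoc, hp.mul_mul_left,
      sub_self]
  have hPX : frobInner P X = frobInner P P := by
    have : frobInner P (W * pinv W * X) = 0 := by
      rw [Matrix.mul_assoc, frobInner_mul_right, hW.eq, hWP, frobInner_zero_left]
    conv_rhs => rw [hP, frobInner_sub_right, ← hP, this, sub_zero]
  have key : ∀ t : ℝ, t * frobInner P P ≤ c := fun t => by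
    have := h (t • P)
    rwa [coupling, frobInner_mul_transpose_eq, Matrix.mul_smul, hWP, smul_zero,
      frobInner_zero_left, frobInner_smul_left, hPX, mul_zero, sub_zero] at this
  have h0 : frobInner P P = 0 := by
    by_contra hne
    have := key ((c + 1) / frobInner P P)
    rw [div_mul_cancel₀ _ hne] at this
    linarith
  rw [rge_le_iff]
  exact (sub_eq_zero.1 (frobInner_self_eq_zero.1 h0)).symm

/-- The partial conjugate of the coupling in its second variable. -/
theorem iSup_coupling {W : Matrix (Fin n) (Fin n) ℝ} (hW : W.PosSemidef)
    (X : Matrix (Fin n) (Fin m) ℝ) :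
    (rge X ≤ rge W → ⨆ Y, (coupling X W Y : EReal) =
      ((1 / 2 * (Xᵀ * pinv W * X).trace : ℝ) : EReal)) ∧
    (¬ rge X ≤ rge W → ⨆ Y, (coupling X W Y : EReal) = ⊤) := by
  have hs := isSymm_of_posSemidef hW
  refine ⟨fun h => le_antisymm (iSup_le fun Y => EReal.coe_le_coe_iff.2 (coupling_le_trace hW h Y))
    ?_, fun h => ?_⟩
  · rw [← coupling_pinv h]
    exact le_iSup (fun Y => (coupling X W Y : EReal)) _
  · rw [EReal.eq_top_iff_forall_lt]
    intro c
    by_contra! hc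
    exact h (rge_le_of_coupling_le hs (c := c) fun Y =>
      EReal.coe_le_coe_iff.1 ((le_iSup (fun Y => (coupling X W Y : EReal)) Y).trans hc))

/-- The concavity gap is exactly ½ab‖Lᵀ(Y - Z)‖². -/
theorem concaveOn_coupling {W : Matrix (Fin n) (Fin n) ℝ} (hW : W.PosSemidef)
    (X : Matrix (Fin n) (Fin m) ℝ) :
    ConcaveOn ℝ Set.univ (coupling X W) := by
  obtain ⟨L, rfl⟩ := exists_eq_mul_transpose hW
  refine ⟨convex_univ, fun Y _ Z _ a b ha hb hab => ?_⟩
  have h := mul_nonneg (mul_nonneg ha hb) (frobInner_self_nonneg (Lᵀ * Y - Lᵀ * Z))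
  simp only [coupling, frobInner_mul_transpose, Matrix.mul_add, Matrix.mul_smul,
    frobInner_add_left, frobInner_add_right, frobInner_smul_left, frobInner_smul_right,
    frobInner_sub_left, frobInner_sub_right, smul_eq_mul, frobInner_comm (Lᵀ * Z) (Lᵀ * Y)]
    at h ⊢
  obtain rfl : b = 1 - a := by linarith
  nlinarith [h]

theorem continuous_coupling_left (X Y : Matrix (Fin n) (Fin m) ℝ) :
    Continuous fun W => coupling X W Y :=
  continuous_const.sub (continuous_const.mul (continuous_frobInner continuous_id continuous_const))

theorem continuous_coupling_right (X : Matrix (Fin n) (Fin m) ℝ)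
    (W : Matrix (Fin n) (Fin n) ℝ) : Continuous fun Y => coupling X W Y :=
  (continuous_frobInner continuous_id continuous_const).sub
    (continuous_const.mul (continuous_frobInner continuous_const (by fun_prop)))

theorem coupling_combo (X Y : Matrix (Fin n) (Fin m) ℝ) (W W' : Matrix (Fin n) (Fin n) ℝ)
    {a b : ℝ} (hab : a + b = 1) :
    coupling X (a • W + b • W') Y = a * coupling X W Y + b * coupling X W' Y := by
  simp only [coupling, frobInner_add_left, frobInner_smul_left]
  linear_combination (-frobInner Y X) * hab

/-! ### Exchanging infimum and supremum. -/

theorem minimax_of_isCompact {K : Set (Matrix (Fin n) (Fin n) ℝ)} (hne : K.Nonempty)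
    (hconv : Convex ℝ K) (hK : IsCompact K) (hpsd : K ⊆ psdCone n)
    (X : Matrix (Fin n) (Fin m) ℝ) :
    ⨅ W ∈ K, ⨆ Y, (coupling X W Y : EReal) = ⨆ Y, ⨅ W ∈ K, (coupling X W Y : EReal) := by
  have h := Sion.minimax' (X := K) (Y := (Set.univ : Set (Matrix (Fin n) (Fin m) ℝ)))
    (f := fun W Y => (coupling X W Y : EReal)) hne hconv hK
    (fun Y _ => (continuous_coe_real_ereal.comp
      (continuous_coupling_left X Y)).lowerSemicontinuous.lowerSemicontinuousOn _)
    (fun Y _ => QuasiconvexOn.monotone_comp (g := Real.toEReal)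
      (f := fun W => coupling X W Y) EReal.coe_strictMono.monotone
      (ConvexOn.quasiconvexOn ⟨hconv, fun W _ W' _ a b _ _ hab =>
        (coupling_combo X Y W W' hab).le⟩)) convex_univ
    (fun W _ => (continuous_coe_real_ereal.comp
      (continuous_coupling_right X W)).upperSemicontinuous.upperSemicontinuousOn _)
    (fun W hW => QuasiconcaveOn.monotone_comp (g := Real.toEReal)
      (f := coupling X W) EReal.coe_strictMono.monotone
      (concaveOn_coupling (hpsd hW) X).quasiconcaveOn)
  simpa using h

/-- With W = LLᵀ and X = LZ, the variable M = LᵀY turns the condition into the ball ‖M - Z‖² ≤ ‖Z‖²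
- 2c, and L is invertible. -/
theorem isCompact_le_coupling {W : Matrix (Fin n) (Fin n) ℝ} (hW : W.PosDef)
    (X : Matrix (Fin n) (Fin m) ℝ) (c : ℝ) : IsCompact {Y | c ≤ coupling X W Y} := by
  obtain ⟨L, rfl⟩ := exists_eq_mul_transpose hW.posSemidef
  have hdet : IsUnit L.det := by
    have := hW.det_pos
    rw [det_mul] at this
    exact (left_ne_zero_of_mul this.ne').isUnit
  set Z := L⁻¹ * X with hZ
  have hX : X = L * Z := by rw [hZ, mul_nonsing_inv_cancel_left _ _ hdet]
  have hdet' : IsUnit Lᵀ.det := by rwa [det_transpose]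
  refine IsCompact.of_isClosed_subset (((isCompact_frobInner_sub_le Z
    (frobInner Z Z - 2 * c))).image (f := fun M => Lᵀ⁻¹ * M) (by fun_prop))
    (isClosed_le continuous_const (continuous_coupling_right X _)) fun Y hY => ?_
  refine ⟨Lᵀ * Y, ?_, nonsing_inv_mul_cancel_left _ _ hdet'⟩
  have hc : c ≤ coupling X (L * Lᵀ) Y := hY
  rw [hX, coupling, frobInner_mul_transpose, frobInner_mul_right] at hc
  simp only [Set.mem_ofPred_eq, frobInner_sub_left, frobInner_sub_right,
    frobInner_comm Z (Lᵀ * Y)]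
  linarith

theorem minimax_of_posDef {V : Set (Matrix (Fin n) (Fin n) ℝ)} (hV : Convex ℝ V)
    (hpd : (V ∩ pdCone n).Nonempty) (X : Matrix (Fin n) (Fin m) ℝ) :
    ⨅ W ∈ V ∩ psdCone n, ⨆ Y, (coupling X W Y : EReal) =
      ⨆ Y, ⨅ W ∈ V ∩ psdCone n, (coupling X W Y : EReal) := by
  obtain ⟨W₀, hW₀V, hW₀⟩ := hpd
  have hW₀' : W₀ ∈ V ∩ psdCone n := ⟨hW₀V, PosDef.posSemidef hW₀⟩
  refine le_antisymm (EReal.le_of_forall_lt_iff_le.1 fun c hc => ?_) ?_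
  -- A common point of all the superlevel sets would make the sup-inf at least `c`. Since the set
  -- for `W₀` is compact, finitely many already have empty intersection; the hull of these matrices
  -- and `W₀` is compact, so Sion's theorem applies to it.
  · obtain ⟨u, hu⟩ := (isCompact_le_coupling hW₀ X c).elim_finite_subfamily_closed
      (fun W : ↥(V ∩ psdCone n) => {Y | c ≤ coupling X W Y})
      (fun W => isClosed_le continuous_const (continuous_coupling_right X _)) (by
        apply Set.eq_empty_of_forall_notMem
        rintro Y ⟨-, hY⟩
        refine hc.not_ge ((le_iInf₂ fun W hW => EReal.coe_le_coe_iff.2 ?_).trans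
          (le_iSup (fun Y => ⨅ W ∈ V ∩ psdCone n, (coupling X W Y : EReal)) Y))
        exact Set.mem_iInter.1 hY ⟨W, hW⟩)
    set s : Set (Matrix (Fin n) (Fin n) ℝ) := insert W₀ (Subtype.val '' (u : Set ↥(V ∩ psdCone n)))
    have hs : s ⊆ V ∩ psdCone n := by
      rintro W (rfl | ⟨W, -, rfl⟩)
      exacts [hW₀', W.2]
    have hfin : s.Finite := (u.finite_toSet.image _).insert _
    have hK : convexHull ℝ s ⊆ V ∩ psdCone n := convexHull_min hs (hV.inter convex_psdCone)
    calc ⨅ W ∈ V ∩ psdCone n, ⨆ Y, (coupling X W Y : EReal)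
        ≤ ⨅ W ∈ convexHull ℝ s, ⨆ Y, (coupling X W Y : EReal) := biInf_mono fun W hW => hK hW
      _ = ⨆ Y, ⨅ W ∈ convexHull ℝ s, (coupling X W Y : EReal) :=
        minimax_of_isCompact ⟨W₀, subset_convexHull ℝ s (Set.mem_insert _ _)⟩
          (convex_convexHull ℝ s) (hfin.isCompact_convexHull ℝ) (hK.trans Set.inter_subset_right) X
      _ ≤ c := iSup_le fun Y => by
        by_contra! hlt
        have hall : ∀ W ∈ s, c ≤ coupling X W Y := fun W hW => EReal.coe_le_coe_iff.1
          (hlt.le.trans (iInf₂_le W (subset_convexHull ℝ s hW)))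
        have : Y ∈ {Y | c ≤ coupling X W₀ Y} ∩ ⋂ W ∈ u, {Y | c ≤ coupling X W.1 Y} :=
          ⟨hall _ (Set.mem_insert _ _), Set.mem_iInter₂.2 fun W hW =>
            hall _ (Set.mem_insert_of_mem _ ⟨W, hW, rfl⟩)⟩
        rw [hu] at this
        exact this
  · exact iSup_le fun Y => le_iInf₂ fun W hW =>
      (iInf₂_le W hW).trans (le_iSup (fun Y => (coupling X W Y : EReal)) Y)

theorem sub_half_iSup {ι : Type*} {S : Set ι} (hS : S.Nonempty) (a : ℝ) (b : ι → ℝ) :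
    (a : EReal) - ((1 / 2 : ℝ) : EReal) * ⨆ i ∈ S, (b i : EReal) =
      ⨅ i ∈ S, ((a - 1 / 2 * b i : ℝ) : EReal) := by
  obtain ⟨i₀, hi₀⟩ := hS
  apply le_antisymm
  · refine le_iInf₂ fun i hi => ?_
    rw [EReal.coe_sub, EReal.coe_mul]
    exact EReal.sub_le_sub le_rfl (mul_le_mul_of_nonneg_left
      (le_iSup₂ (f := fun i (_ : i ∈ S) => (b i : EReal)) i hi)
      (EReal.coe_nonneg.2 (by norm_num)))
  · refine EReal.ge_of_forall_gt_iff_ge.1 fun r hr => ?_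
    -- A real `r` below every `a - b i / 2` bounds every `b i` by `2 * (a - r)`.
    have hb : ⨆ i ∈ S, (b i : EReal) ≤ ((2 * (a - r) : ℝ) : EReal) := iSup₂_le fun i hi => by
      have := EReal.coe_lt_coe_iff.1 (hr.trans_le (iInf₂_le i hi))
      exact EReal.coe_le_coe_iff.2 (by linarith)
    calc (r : EReal) = (a : EReal) - ((1 / 2 : ℝ) : EReal) * ((2 * (a - r) : ℝ) : EReal) := by
          rw [← EReal.coe_mul, ← EReal.coe_sub]
          congr 1
          ring
      _ ≤ _ := EReal.sub_le_sub le_rfl (mul_le_mul_of_nonneg_left hb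
        (EReal.coe_nonneg.2 (by norm_num)))

/-- The conjugate of the variational Gram function as a minimum over the matrices. -/
theorem conjFn_gramFn {V : Set (Matrix (Fin n) (Fin n) ℝ)} (hclosed : IsClosed V)
    (hconv : Convex ℝ V)
    (h : (V ∩ pdCone n).Nonempty ∨ ((V ∩ psdCone n).Nonempty ∧ FrobBounded (V ∩ psdCone n)))
    (X : Matrix (Fin n) (Fin m) ℝ) :
    conjFn (gramFn m V) X = ⨅ W ∈ V ∩ psdCone n, ⨆ Y, (coupling X W Y : EReal) := by
  have hne : (V ∩ psdCone n).Nonempty := by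
    rcases h with ⟨W, hW, hpd⟩ | h
    exacts [⟨W, hW, PosDef.posSemidef hpd⟩, h.1]
  calc conjFn (gramFn m V) X = ⨆ Y, ⨅ W ∈ V ∩ psdCone n, (coupling X W Y : EReal) :=
        iSup_congr fun Y => sub_half_iSup hne _ _
    _ = _ := by
      rcases h with h | h
      · exact (minimax_of_posDef hconv h X).symm
      · exact (minimax_of_isCompact hne (hconv.inter convex_psdCone)
          (isCompact_of_frobBounded (hclosed.inter isClosed_psdCone) h.2)
          Set.inter_subset_right X).symm

/-! ### The support function of Ω(0, 0). -/

theorem coneK_zero (l : ℕ) : coneK (0 : Matrix (Fin l) (Fin n) ℝ) = psdCone n := by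
  ext W
  simp [coneK, psdCone, symMat, posSemidef_iff_frobInner, frobInner_vecMulVec]

theorem polarSet_psdCone_inter_symMat : polarSet (psdCone n) ∩ symMat n = nsdCone n := by
  ext M
  constructor
  · rintro ⟨hM, hs⟩
    refine posSemidef_iff_frobInner.2 ⟨IsSymm.neg hs, fun u => ?_⟩
    rw [frobInner_neg_left]
    by_contra! hneg
    have hpos : 0 < frobInner M (vecMulVec u u) := by linarith
    -- On a cone the bound 1 amounts to the bound 0: this multiple would pair to 2.
    have := hM ((2 / frobInner M (vecMulVec u u)) • vecMulVec u u)
      ((posSemidef_vecMulVec u).smul (by positivity))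
    rw [frobInner_smul_right, div_mul_cancel₀ _ hpos.ne'] at this
    linarith
  · intro hM
    have hM' : (-M).PosSemidef := hM
    refine ⟨fun P hP => ?_, show M.IsSymm by simpa using (isSymm_of_posSemidef hM').neg⟩
    have := frobInner_nonneg_of_posSemidef hM' hP
    rw [frobInner_neg_left] at this
    linarith

theorem mem_setOmega_zero {l : ℕ} {Y : Matrix (Fin n) (Fin m) ℝ} {T : Matrix (Fin n) (Fin n) ℝ} :
    (Y, T) ∈ setOmega (0 : Matrix (Fin l) (Fin n) ℝ) (0 : Matrix (Fin l) (Fin m) ℝ) ↔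
      T.IsSymm ∧ (-((1 / 2 : ℝ) • (Y * Yᵀ) + T)).PosSemidef := by
  simp only [setOmega, coneK_zero, polarSet_psdCone_inter_symMat, Matrix.zero_mul, true_and,
    Set.mem_ofPred_eq]
  rfl

/-- Pairing with W ⪰ 0 is monotone, so for fixed Y the best second component is the largest
admissible one, -½YYᵀ. -/
theorem supportFnProd_setOmega_of_posSemidef (l : ℕ) (X : Matrix (Fin n) (Fin m) ℝ)
    {W : Matrix (Fin n) (Fin n) ℝ} (hW : W.PosSemidef) :
    supportFnProd (setOmega (0 : Matrix (Fin l) (Fin n) ℝ) (0 : Matrix (Fin l) (Fin m) ℝ)) X W =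
      ⨆ Y, (coupling X W Y : EReal) := by
  apply le_antisymm
  · refine iSup₂_le fun P hP => le_iSup_of_le P.1 (EReal.coe_le_coe_iff.2 ?_)
    have h := frobInner_nonneg_of_posSemidef (mem_setOmega_zero.1 hP).2 hW
    rw [frobInner_neg_left, frobInner_add_left, frobInner_smul_left] at h
    rw [coupling, frobInner_comm W]
    linarith
  · refine iSup_le fun Y => le_iSup₂_of_le (Y, -((1 / 2 : ℝ) • (Y * Yᵀ))) ?_
      (EReal.coe_le_coe_iff.2 ?_)
    · refine mem_setOmega_zero.2 ⟨?_, ?_⟩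
      · exact ((isSymm_of_posSemidef (posSemidef_mul_transpose Y)).smul _).neg
      · simpa using PosSemidef.zero
    · rw [coupling, frobInner_neg_left, frobInner_smul_left, frobInner_comm W, sub_eq_add_neg]

theorem supportFnProd_setOmega_of_not_posSemidef (l : ℕ) (X : Matrix (Fin n) (Fin m) ℝ)
    {W : Matrix (Fin n) (Fin n) ℝ} (hs : W.IsSymm) (hW : ¬ W.PosSemidef) :
    supportFnProd (setOmega (0 : Matrix (Fin l) (Fin n) ℝ) (0 : Matrix (Fin l) (Fin m) ℝ)) X W =
      ⊤ := by
  rw [posSemidef_iff_frobInner] at hW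
  push Not at hW
  obtain ⟨u, hu⟩ := hW hs
  rw [EReal.eq_top_iff_forall_lt]
  intro c
  -- The pair (0, -t uuᵀ) lies in Ω(0, 0) and then has value `|c| + 1`.
  set t := (|c| + 1) / -frobInner W (vecMulVec u u) with ht
  have ht0 : 0 ≤ t := div_nonneg (by positivity) (by linarith)
  have hmem : ((0 : Matrix (Fin n) (Fin m) ℝ), -(t • vecMulVec u u)) ∈
      setOmega (0 : Matrix (Fin l) (Fin n) ℝ) (0 : Matrix (Fin l) (Fin m) ℝ) := by
    have hp := (posSemidef_vecMulVec u).smul ht0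
    exact mem_setOmega_zero.2 ⟨(isSymm_of_posSemidef hp).neg, by simpa using hp⟩
  refine lt_of_lt_of_le (EReal.coe_lt_coe_iff.2 ?_) (le_iSup₂ (f := fun P (_ : P ∈ setOmega
    (0 : Matrix (Fin l) (Fin n) ℝ) (0 : Matrix (Fin l) (Fin m) ℝ)) =>
    ((frobInner P.1 X + frobInner P.2 W : ℝ) : EReal)) _ hmem)
  have htu : t * -frobInner W (vecMulVec u u) = |c| + 1 := div_mul_cancel₀ _ (by linarith)
  rw [frobInner_zero_left, frobInner_neg_left, frobInner_smul_left, frobInner_comm _ W]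
  linarith [le_abs_self c]

theorem iInf_supportFnProd_setOmega (l : ℕ) {V : Set (Matrix (Fin n) (Fin n) ℝ)}
    (hV : V ⊆ symMat n) (X : Matrix (Fin n) (Fin m) ℝ) :
    ⨅ W ∈ symMat n, (supportFnProd
      (setOmega (0 : Matrix (Fin l) (Fin n) ℝ) (0 : Matrix (Fin l) (Fin m) ℝ)) X W +
        indicatorFn V W) =
      ⨅ W ∈ V ∩ psdCone n, ⨆ Y, (coupling X W Y : EReal) := by
  apply le_antisymm
  · refine le_iInf₂ fun W hW => iInf₂_le_of_le W (hV hW.1) ?_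
    rw [supportFnProd_setOmega_of_posSemidef l X hW.2, indicatorFn, if_pos hW.1, add_zero]
  · refine le_iInf₂ fun W hW => ?_
    by_cases hWV : W ∈ V
    · rw [indicatorFn, if_pos hWV, add_zero]
      by_cases hp : W.PosSemidef
      · rw [supportFnProd_setOmega_of_posSemidef l X hp]
        exact iInf₂_le W ⟨hWV, hp⟩
      · rw [supportFnProd_setOmega_of_not_posSemidef l X hW hp]
        exact le_top
    · rw [indicatorFn, if_neg hWV, EReal.add_top_of_ne_bot]
      · exact le_top
      -- In `EReal`, `⊥ + ⊤ = ⊥`, so the value `⊥` must be excluded; the pair (0, 0) does this.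
      · intro hbot
        have h0 : ((0 : Matrix (Fin n) (Fin m) ℝ), (0 : Matrix (Fin n) (Fin n) ℝ)) ∈
            setOmega (0 : Matrix (Fin l) (Fin n) ℝ) (0 : Matrix (Fin l) (Fin m) ℝ) :=
          mem_setOmega_zero.2 ⟨isSymm_zero, by simpa using PosSemidef.zero⟩
        have := le_iSup₂ (f := fun P (_ : P ∈ setOmega
          (0 : Matrix (Fin l) (Fin n) ℝ) (0 : Matrix (Fin l) (Fin m) ℝ)) =>
          ((frobInner P.1 X + frobInner P.2 W : ℝ) : EReal)) _ h0
        exact EReal.coe_ne_bot _ (le_bot_iff.1 (this.trans hbot.le))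

/-! ### The pseudoinverse formula and finiteness. -/

theorem coe_half_mul_iInf₂ {ι : Type*} {p : ι → Prop} (f : ι → ℝ) :
    ((1 / 2 : ℝ) : EReal) * ⨅ (i) (_ : p i), (f i : EReal) =
      ⨅ (i) (_ : p i), ((1 / 2 * f i : ℝ) : EReal) := by
  have hle : ∀ {a b : EReal}, a ≤ b → ∀ {r : ℝ}, 0 ≤ r → (r : EReal) * a ≤ r * b :=
    fun h _ hr => mul_le_mul_of_nonneg_left h (EReal.coe_nonneg.2 hr)
  apply le_antisymm
  · refine le_iInf₂ fun i hi => ?_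
    rw [EReal.coe_mul]
    exact hle (iInf₂_le i hi) (by norm_num)
  -- The easy inequality for the factor 2, multiplied by ½, is the reverse inequality.
  · have h2 : ((2 : ℝ) : EReal) * ⨅ (i) (_ : p i), ((1 / 2 * f i : ℝ) : EReal) ≤
        ⨅ (i) (_ : p i), (f i : EReal) := le_iInf₂ fun i hi => by
      refine (hle (iInf₂_le i hi) (by norm_num)).trans_eq ?_
      rw [← EReal.coe_mul]
      congr 1
      ring
    calc _ = ((1 / 2 : ℝ) : EReal) * (((2 : ℝ) : EReal) *
          ⨅ (i) (_ : p i), ((1 / 2 * f i : ℝ) : EReal)) := by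
          rw [← mul_assoc, ← EReal.coe_mul]
          norm_num
      _ ≤ _ := hle h2 (by norm_num)

theorem iInf_iSup_coupling (V : Set (Matrix (Fin n) (Fin n) ℝ)) (X : Matrix (Fin n) (Fin m) ℝ) :
    ⨅ W ∈ V ∩ psdCone n, ⨆ Y, (coupling X W Y : EReal) =
      ((1 / 2 : ℝ) : EReal) * ⨅ (W : Matrix (Fin n) (Fin n) ℝ)
        (_ : W ∈ V ∩ psdCone n ∧ rge X ≤ rge W), ((Xᵀ * pinv W * X).trace : EReal) := by
  rw [coe_half_mul_iInf₂]
  apply le_antisymm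
  · exact le_iInf₂ fun W hW => iInf₂_le_of_le W hW.1 ((iSup_coupling hW.1.2 X).1 hW.2).le
  · refine le_iInf₂ fun W hW => ?_
    by_cases h : rge X ≤ rge W
    · exact iInf₂_le_of_le W ⟨hW, h⟩ ((iSup_coupling hW.2 X).1 h).ge
    · rw [(iSup_coupling hW.2 X).2 h]
      exact le_top

theorem rge_le_of_posDef {W : Matrix (Fin n) (Fin n) ℝ} (hW : W.PosDef)
    (X : Matrix (Fin n) (Fin m) ℝ) : rge X ≤ rge W := by
  rintro _ ⟨v, rfl⟩
  refine ⟨(W⁻¹ * X) *ᵥ v, ?_⟩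
  simp [mulVec_mulVec, mul_nonsing_inv_cancel_left _ _ hW.det_pos.ne'.isUnit]

/-- The infimal representation is finite as soon as it has a positive definite competitor. -/
theorem iInf_iSup_coupling_ne {V : Set (Matrix (Fin n) (Fin n) ℝ)}
    (hV : (V ∩ pdCone n).Nonempty) (X : Matrix (Fin n) (Fin m) ℝ) :
    (⨅ W ∈ V ∩ psdCone n, ⨆ Y, (coupling X W Y : EReal)) ≠ ⊤ ∧
      (⨅ W ∈ V ∩ psdCone n, ⨆ Y, (coupling X W Y : EReal)) ≠ ⊥ := by
  obtain ⟨W, hWV, hW⟩ := hV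
  have hp : W.PosSemidef := PosDef.posSemidef hW
  constructor
  · refine ne_top_of_le_ne_top (EReal.coe_ne_top _) ((iInf₂_le W ⟨hWV, hp⟩).trans
      ((iSup_coupling hp X).1 (rge_le_of_posDef hW X)).le)
  -- Y = 0 makes every inner supremum nonnegative.
  · refine ne_bot_of_le_ne_bot EReal.zero_ne_bot (le_iInf₂ fun W _ => le_iSup_of_le 0 ?_)
    rw [coupling_zero, EReal.coe_zero]

theorem frobInner_le_mul_frobNorm (X Y : Matrix (Fin n) (Fin m) ℝ) :
    frobInner X Y ≤ frobNorm X * ∑ i, ∑ j, |Y i j| := by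
  rw [frobInner_eq_sum, Finset.mul_sum]
  refine Finset.sum_le_sum fun i _ => ?_
  rw [Finset.mul_sum]
  refine Finset.sum_le_sum fun j _ => ?_
  calc X i j * Y i j ≤ |X i j| * |Y i j| := by rw [← abs_mul]; exact le_abs_self _
    _ ≤ _ := mul_le_mul_of_nonneg_right (abs_apply_le_frobNorm X i j) (abs_nonneg _)

theorem gramFn_ne {V : Set (Matrix (Fin n) (Fin n) ℝ)} (hne : (V ∩ psdCone n).Nonempty)
    (hb : FrobBounded (V ∩ psdCone n)) (Y : Matrix (Fin n) (Fin m) ℝ) :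
    gramFn m V Y ≠ ⊤ ∧ gramFn m V Y ≠ ⊥ := by
  obtain ⟨W₀, hW₀⟩ := hne
  obtain ⟨C, hC⟩ := hb
  have h1 : supportFn (V ∩ psdCone n) (Y * Yᵀ) ≤
      ((C * ∑ i, ∑ j, |(Y * Yᵀ) i j| : ℝ) : EReal) := iSup₂_le fun W hW =>
    EReal.coe_le_coe_iff.2 ((frobInner_le_mul_frobNorm _ _).trans
      (mul_le_mul_of_nonneg_right (hC W hW)
        (Finset.sum_nonneg fun _ _ => Finset.sum_nonneg fun _ _ => abs_nonneg _)))
  have h2 : (frobInner W₀ (Y * Yᵀ) : EReal) ≤ supportFn (V ∩ psdCone n) (Y * Yᵀ) :=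
    le_iSup₂ (f := fun W (_ : W ∈ V ∩ psdCone n) => (frobInner W (Y * Yᵀ) : EReal)) W₀ hW₀
  have h3 : supportFn (V ∩ psdCone n) (Y * Yᵀ) ≠ ⊤ := ne_top_of_le_ne_top (EReal.coe_ne_top _) h1
  have h4 : supportFn (V ∩ psdCone n) (Y * Yᵀ) ≠ ⊥ := ne_bot_of_le_ne_bot (EReal.coe_ne_bot _) h2
  lift supportFn (V ∩ psdCone n) (Y * Yᵀ) to ℝ using ⟨h3, h4⟩ with s hs
  rw [gramFn, ← hs, ← EReal.coe_mul]
  exact ⟨EReal.coe_ne_top _, EReal.coe_ne_bot _⟩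

/-! ### Squared gauges. -/

/-- Common criterion for both gauge identities. Testing only levels `c` strictly above `a` avoids
any need for the infima to be attained. -/
theorem eq_half_mul_gaugeFn_sq {S : Set (Matrix (Fin n) (Fin m) ℝ)}
    {X : Matrix (Fin n) (Fin m) ℝ} {a : EReal} (h0 : 0 ≤ a)
    (h1 : ∀ t : ℝ, 0 ≤ t → X ∈ t • S → a ≤ ((1 / 2 * t ^ 2 : ℝ) : EReal))
    (h2 : ∀ c : ℝ, 0 < c → a < c → X ∈ Real.sqrt (2 * c) • S) :
    a = ((1 / 2 : ℝ) : EReal) * gaugeFn S X ^ 2 := by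
  have hg0 : 0 ≤ gaugeFn S X := le_iInf₂ fun t ht => EReal.coe_nonneg.2 ht.1
  apply le_antisymm
  · by_cases htop : gaugeFn S X = ⊤
    · rw [htop, sq, EReal.top_mul_top, EReal.coe_mul_top_of_pos (by norm_num)]
      exact le_top
    · have hex : ∃ g : ℝ, (g : EReal) = gaugeFn S X :=
        ⟨_, EReal.coe_toReal htop (ne_bot_of_le_ne_bot EReal.zero_ne_bot hg0)⟩
      obtain ⟨g, hg⟩ := hex
      rw [← hg] at hg0 ⊢
      have hg0' : 0 ≤ g := EReal.coe_nonneg.1 hg0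
      refine EReal.le_of_forall_lt_iff_le.1 fun c hc => ?_
      rw [← EReal.coe_pow, ← EReal.coe_mul, EReal.coe_lt_coe_iff] at hc
      have hlt : gaugeFn S X < (Real.sqrt (2 * c) : EReal) := by
        rw [← hg, EReal.coe_lt_coe_iff]
        exact Real.lt_sqrt_of_sq_lt (by linarith)
      simp only [gaugeFn, iInf_lt_iff] at hlt
      obtain ⟨t, ht, htc⟩ := hlt
      refine (h1 t ht.1 ht.2).trans (EReal.coe_le_coe_iff.2 ?_)
      have hsq : t ^ 2 ≤ 2 * c := by
        have h3 := pow_le_pow_left₀ ht.1 (EReal.coe_lt_coe_iff.1 htc).le 2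
        rwa [Real.sq_sqrt (by nlinarith [sq_nonneg g])] at h3
      linarith
  · refine EReal.le_of_forall_lt_iff_le.1 fun c hc => ?_
    have hc0 : 0 < c := EReal.coe_pos.1 (h0.trans_lt hc)
    have hle : gaugeFn S X ≤ (Real.sqrt (2 * c) : EReal) :=
      iInf₂_le _ ⟨Real.sqrt_nonneg _, h2 c hc0 hc⟩
    calc ((1 / 2 : ℝ) : EReal) * gaugeFn S X ^ 2
        ≤ ((1 / 2 : ℝ) : EReal) * (Real.sqrt (2 * c) : EReal) ^ 2 :=
          mul_le_mul_of_nonneg_left (pow_le_pow_left₀ hg0 hle 2)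
            (EReal.coe_nonneg.2 (by norm_num))
      _ = c := by
          rw [← EReal.coe_pow, ← EReal.coe_mul, Real.sq_sqrt (by linarith)]
          congr 1
          ring

theorem half_frobInner_le_gramFn {V : Set (Matrix (Fin n) (Fin n) ℝ)}
    {W : Matrix (Fin n) (Fin n) ℝ} (hW : W ∈ V ∩ psdCone n) (Y : Matrix (Fin n) (Fin m) ℝ) :
    ((1 / 2 * frobInner W (Y * Yᵀ) : ℝ) : EReal) ≤ gramFn m V Y := by
  rw [EReal.coe_mul]
  exact mul_le_mul_of_nonneg_left
    (le_iSup₂ (f := fun W (_ : W ∈ V ∩ psdCone n) => (frobInner W (Y * Yᵀ) : EReal)) W hW)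
    (EReal.coe_nonneg.2 (by norm_num))

theorem mem_polarSet_factorSet {V : Set (Matrix (Fin n) (Fin n) ℝ)}
    {Y : Matrix (Fin n) (Fin m) ℝ} :
    Y ∈ polarSet (factorSet m V) ↔ ∀ W ∈ V ∩ psdCone n, frobInner W (Y * Yᵀ) ≤ 1 := by
  constructor
  · intro hY W hW
    obtain ⟨L, rfl⟩ := exists_eq_mul_transpose hW.2
    rw [frobInner_mul_transpose]
    by_contra! ha
    set a := frobInner (Lᵀ * Y) (Lᵀ * Y)
    have hs : 1 < Real.sqrt a := Real.lt_sqrt_of_sq_lt (by simpa using ha)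
    have hsq : Real.sqrt a * Real.sqrt a = a := Real.mul_self_sqrt (by linarith)
    -- The normalized LᵀY maximizes ⟨LᵀY, Z⟩ over the unit ball.
    have h := hY _ ⟨L, (Real.sqrt a)⁻¹ • (Lᵀ * Y), hW, ?_, rfl⟩
    · rw [frobInner_mul_right, frobInner_smul_right] at h
      change (Real.sqrt a)⁻¹ * a ≤ 1 at h
      rw [inv_mul_le_iff₀ (by linarith)] at h
      nlinarith
    · rw [frobNorm, frobInner_smul_left, frobInner_smul_right]
      change Real.sqrt ((Real.sqrt a)⁻¹ * ((Real.sqrt a)⁻¹ * a)) ≤ 1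
      rw [← mul_assoc, ← mul_inv, hsq, inv_mul_cancel₀ (by linarith), Real.sqrt_one]
  · rintro h _ ⟨L, Z, hL, hZ, rfl⟩
    have h1 := h _ hL
    have h2 := frobInner_le_of_frobNorm_le hZ
    have h3 := frobInner_self_nonneg (Lᵀ * Y - Z)
    rw [frobInner_mul_transpose] at h1
    rw [frobInner_mul_right]
    simp only [frobInner_sub_left, frobInner_sub_right, frobInner_comm Z (Lᵀ * Y)] at h3
    linarith

theorem frobInner_smul_mul_transpose (t : ℝ) (W : Matrix (Fin n) (Fin n) ℝ)
    (Y : Matrix (Fin n) (Fin m) ℝ) :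
    frobInner W ((t • Y) * (t • Y)ᵀ) = t ^ 2 * frobInner W (Y * Yᵀ) := by
  rw [transpose_smul, Matrix.smul_mul, Matrix.mul_smul, smul_smul, frobInner_smul_right, sq]

/-- Φ is homogeneous of degree 2 and F° is its sublevel set at ½; 0 ∈ V supplies Φ ≥ 0. -/
theorem gramFn_eq_gaugeFn {V : Set (Matrix (Fin n) (Fin n) ℝ)}
    (h0 : (0 : Matrix (Fin n) (Fin n) ℝ) ∈ V) (Y : Matrix (Fin n) (Fin m) ℝ) :
    gramFn m V Y =
      ((1 / 2 : ℝ) : EReal) * gaugeFn (polarSet (factorSet m V)) Y ^ 2 := by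
  refine eq_half_mul_gaugeFn_sq ?_ ?_ ?_
  · simpa [frobInner_zero_left] using
      half_frobInner_le_gramFn (V := V) ⟨h0, (PosSemidef.zero : PosSemidef (0 : Matrix _ _ ℝ))⟩ Y
  · rintro t ht ⟨Y, hY, rfl⟩
    rw [EReal.coe_mul]
    refine mul_le_mul_of_nonneg_left (iSup₂_le fun W hW => EReal.coe_le_coe_iff.2 ?_)
      (EReal.coe_nonneg.2 (by norm_num))
    change frobInner W ((t • Y) * (t • Y)ᵀ) ≤ _
    rw [frobInner_smul_mul_transpose]
    exact mul_le_of_le_one_right (sq_nonneg t) (mem_polarSet_factorSet.1 hY W hW)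
  · intro c hc hlt
    have hs : Real.sqrt (2 * c) ≠ 0 := (Real.sqrt_pos.2 (by linarith)).ne'
    refine ⟨(Real.sqrt (2 * c))⁻¹ • Y, mem_polarSet_factorSet.2 fun W hW => ?_,
      smul_inv_smul₀ hs Y⟩
    have h1 := EReal.coe_le_coe_iff.1 ((half_frobInner_le_gramFn hW Y).trans hlt.le)
    rw [frobInner_smul_mul_transpose, inv_pow, Real.sq_sqrt (by linarith),
      inv_mul_le_iff₀ (by linarith)]
    linarith

theorem iInf_iSup_coupling_eq_gaugeFn (V : Set (Matrix (Fin n) (Fin n) ℝ))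
    (X : Matrix (Fin n) (Fin m) ℝ) :
    ⨅ W ∈ V ∩ psdCone n, ⨆ Y, (coupling X W Y : EReal) =
      ((1 / 2 : ℝ) : EReal) * gaugeFn (factorSet m V) X ^ 2 := by
  refine eq_half_mul_gaugeFn_sq ?_ ?_ ?_
  · refine le_iInf₂ fun W _ => le_iSup_of_le 0 ?_
    rw [coupling_zero, EReal.coe_zero]
  · rintro t ht ⟨_, ⟨L, Z, hL, hZ, rfl⟩, rfl⟩
    refine iInf₂_le_of_le _ hL (iSup_le fun Y => EReal.coe_le_coe_iff.2 ?_)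
    change coupling (t • (L * Z)) _ Y ≤ _
    have h1 := coupling_mul_le L (t • Z) Y
    rw [Matrix.mul_smul, frobInner_smul_left, frobInner_smul_right] at h1
    nlinarith [mul_le_mul_of_nonneg_left (frobInner_le_of_frobNorm_le hZ) (sq_nonneg t)]
  · intro c hc hlt
    simp only [iInf_lt_iff] at hlt
    obtain ⟨W, hW, hWc⟩ := hlt
    obtain ⟨L, rfl⟩ := exists_eq_mul_transpose hW.2
    have hr : rge X ≤ rge (L * Lᵀ) := by
      by_contra hr
      rw [(iSup_coupling hW.2 X).2 hr] at hWc
      exact not_top_lt hWc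
    rw [(iSup_coupling hW.2 X).1 hr, EReal.coe_lt_coe_iff] at hWc
    obtain ⟨hX, htr⟩ := factor_of_rge_le L X hr
    set Z := Lᵀ * pinv (L * Lᵀ) * X
    have hs : Real.sqrt (2 * c) ≠ 0 := (Real.sqrt_pos.2 (by linarith)).ne'
    -- ‖Z‖² = tr(XᵀW†X) < 2c, so the rescaled factor lies in the unit ball.
    refine ⟨L * ((Real.sqrt (2 * c))⁻¹ • Z), ⟨L, _, hW, ?_, rfl⟩, ?_⟩
    · rw [frobNorm, frobInner_smul_left, frobInner_smul_right, ← mul_assoc, ← mul_inv,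
        Real.mul_self_sqrt (by linarith), Real.sqrt_le_one, inv_mul_le_iff₀ (by linarith)]
      linarith
    · change Real.sqrt (2 * c) • (L * ((Real.sqrt (2 * c))⁻¹ • Z)) = X
      rw [Matrix.mul_smul, smul_inv_smul₀ hs, hX]

/-! ### Boundedness and the barrier cone. -/

/-- A direction on which every functional bounded above on a closed convex set is nonnegative is
a recession direction. -/
theorem add_smul_mem_of_recession {V : Set (Matrix (Fin n) (Fin n) ℝ)} (hV : IsClosed V)
    (hconv : Convex ℝ V) {W H : Matrix (Fin n) (Fin n) ℝ} (hW : W ∈ V)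
    (hH : ∀ B, (∃ c, ∀ U ∈ V, frobInner U B ≤ c) → frobInner H B ≤ 0) {t : ℝ} (ht : 0 ≤ t) :
    W + t • H ∈ V := by
  by_contra hnot
  have : LocallyConvexSpace ℝ (Matrix (Fin n) (Fin n) ℝ) :=
    inferInstanceAs (LocallyConvexSpace ℝ (Fin n → Fin n → ℝ))
  obtain ⟨f, u, hfu, hlt⟩ := geometric_hahn_banach_closed_point hconv hV hnot
  obtain ⟨B, hB⟩ := exists_frobInner_eq f.toLinearMap
  have hB' : ∀ U, f U = frobInner U B := fun U => (hB U).trans (frobInner_comm _ _)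
  -- The separating functional is bounded above on `V`, hence nonpositive at `H`, so it cannot be
  -- larger at `W + t • H` than at `W`.
  have h1 := hH B ⟨u, fun U hU => by rw [← hB']; exact (hfu U hU).le⟩
  have h2 := hfu W hW
  rw [hB'] at h2 hlt
  rw [frobInner_add_left, frobInner_smul_left] at hlt
  nlinarith [mul_nonneg ht (neg_nonneg.2 h1)]

-- The decomposable matrices form a convex cone. A functional ⟨H, ·⟩ nonpositive on it has H ⪰ 0
-- (test the `N` part) and H a recession direction of `V` (test the `B` part), so W₀ + tH stays in a
-- bounded set and H = 0. Here `N` and `B` may be nonsymmetric; symmetrization comes later.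
open scoped Matrix.Norms.Elementwise in
theorem exists_decomposition_of_frobBounded {V : Set (Matrix (Fin n) (Fin n) ℝ)}
    (hclosed : IsClosed V) (hconv : Convex ℝ V)
    (hne : (V ∩ psdCone n).Nonempty) (hb : FrobBounded (V ∩ psdCone n))
    (U : Matrix (Fin n) (Fin n) ℝ) :
    ∃ N B, U = N + B ∧ (∀ P : Matrix (Fin n) (Fin n) ℝ, P.PosSemidef → frobInner P N ≤ 0) ∧
      ∃ c, ∀ W ∈ V, frobInner W B ≤ c := by
  obtain ⟨W₀, hW₀V, hW₀⟩ := hne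
  obtain ⟨C, hC⟩ := hb
  have key := eq_univ_of_forall_linear_nonpos (E := Matrix (Fin n) (Fin n) ℝ)
    (C := {U | ∃ N B, U = N + B ∧
      (∀ P : Matrix (Fin n) (Fin n) ℝ, P.PosSemidef → frobInner P N ≤ 0) ∧
      ∃ c, ∀ W ∈ V, frobInner W B ≤ c}) ?_ ?_ ?_ ?_
  · have : U ∈ Set.univ := trivial
    rwa [← key] at this
  · exact ⟨0, 0, by simp, fun P _ => by simp [frobInner_zero_right],
      0, fun W _ => by simp [frobInner_zero_right]⟩
  · rintro _ ⟨N, B, rfl, hN, c, hc⟩ _ ⟨N', B', rfl, hN', c', hc'⟩ a b ha hb _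
    refine ⟨a • N + b • N', a • B + b • B', by simp only [smul_add]; abel, fun P hP => ?_,
      a * c + b * c', fun W hW => ?_⟩
    · rw [frobInner_add_right, frobInner_smul_right, frobInner_smul_right]
      nlinarith [mul_nonneg ha (neg_nonneg.2 (hN P hP)), mul_nonneg hb (neg_nonneg.2 (hN' P hP))]
    · rw [frobInner_add_right, frobInner_smul_right, frobInner_smul_right]
      exact add_le_add (mul_le_mul_of_nonneg_left (hc W hW) ha)
        (mul_le_mul_of_nonneg_left (hc' W hW) hb)
  · rintro t ht _ ⟨N, B, rfl, hN, c, hc⟩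
    refine ⟨t • N, t • B, smul_add _ _ _, fun P hP => ?_, t * c, fun W hW => ?_⟩
    · rw [frobInner_smul_right]
      exact mul_nonpos_of_nonneg_of_nonpos ht (hN P hP)
    · rw [frobInner_smul_right]
      exact mul_le_mul_of_nonneg_left (hc W hW) ht
  · intro f hf
    obtain ⟨H, hH⟩ := exists_frobInner_eq f
    have hN : ∀ N, (∀ P : Matrix (Fin n) (Fin n) ℝ, P.PosSemidef → frobInner P N ≤ 0) →
        frobInner H N ≤ 0 := fun N h => by
      rw [← hH]
      exact hf N ⟨N, 0, by simp, h, 0, fun W _ => by simp [frobInner_zero_right]⟩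
    have hB : ∀ B, (∃ c, ∀ U ∈ V, frobInner U B ≤ c) → frobInner H B ≤ 0 := fun B h => by
      rw [← hH]
      exact hf B ⟨0, B, by simp, fun P _ => by simp [frobInner_zero_right], h⟩
    have hHs : H.IsSymm := by
      -- Antisymmetric matrices pair to zero with positive semidefinite ones, so they are admissible
      -- as `N`.
      have h1 := hN (H - Hᵀ) fun P hP => by
        rw [frobInner_sub_right, ← frobInner_transpose P H, (isSymm_of_posSemidef hP).eq, sub_self]
      have h2 := frobInner_self_nonneg (H - Hᵀ)
      have h3 : frobInner (H - Hᵀ) (H - Hᵀ) = 2 * frobInner H (H - Hᵀ) := by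
        simp only [frobInner_sub_left, frobInner_sub_right, frobInner_transpose,
          frobInner_comm Hᵀ H]
        ring
      exact (sub_eq_zero.1 (frobInner_self_eq_zero.1 (by linarith))).symm
    have hHp : H.PosSemidef := posSemidef_iff_frobInner.2 ⟨hHs, fun u => by
      have := hN (-vecMulVec u u) fun P hP => by
        have := frobInner_nonneg_of_posSemidef hP (posSemidef_vecMulVec u)
        rw [frobInner_neg_right]
        linarith
      rw [frobInner_neg_right] at this
      linarith⟩
    have hbd : ∀ t : ℝ, 0 ≤ t → t ^ 2 * frobInner H H ≤ C ^ 2 := fun t ht => by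
      have h1 := frobInner_le_of_frobNorm_le (hC (W₀ + t • H)
        ⟨add_smul_mem_of_recession hclosed hconv hW₀V hB ht,
          PosSemidef.add hW₀ (hHp.smul ht)⟩)
      have h2 := frobInner_nonneg_of_posSemidef hW₀ hHp
      have h3 := frobInner_self_nonneg W₀
      simp only [frobInner_add_left, frobInner_add_right, frobInner_smul_left,
        frobInner_smul_right, frobInner_comm H W₀] at h1
      nlinarith [mul_nonneg ht h2]
    have hH0 : H = 0 := by
      rw [← frobInner_self_eq_zero]
      by_contra hne
      have hpos : 0 < frobInner H H := lt_of_le_of_ne (frobInner_self_nonneg H) (Ne.symm hne)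
      -- This `t` makes t²‖H‖² equal to C² + 1.
      have h1 := hbd (Real.sqrt ((C ^ 2 + 1) / frobInner H H)) (Real.sqrt_nonneg _)
      rw [Real.sq_sqrt (by positivity), div_mul_cancel₀ _ hne] at h1
      linarith
    ext X
    simp [hH, hH0, frobInner_zero_left]

theorem frobInner_symmetrize {W : Matrix (Fin n) (Fin n) ℝ} (hW : W.IsSymm)
    (B : Matrix (Fin n) (Fin n) ℝ) :
    frobInner W ((1 / 2 : ℝ) • (B + Bᵀ)) = frobInner W B := by
  have h := frobInner_transpose W B
  rw [hW.eq] at h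
  rw [frobInner_smul_right, frobInner_add_right, h]
  ring

theorem isSymm_symmetrize (B : Matrix (Fin n) (Fin n) ℝ) :
    ((1 / 2 : ℝ) • (B + Bᵀ)).IsSymm := by
  simp [IsSymm, add_comm]

theorem frobBounded_iff {V : Set (Matrix (Fin n) (Fin n) ℝ)}
    (hsymm : V ⊆ symMat n) (hclosed : IsClosed V) (hconv : Convex ℝ V)
    (hne : (V ∩ psdCone n).Nonempty) :
    FrobBounded (V ∩ psdCone n) ↔ nsdCone n + barrierCone V = symMat n := by
  constructor
  · intro hb
    apply Set.Subset.antisymm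
    · rintro _ ⟨N, hN, B, hB, rfl⟩
      have hN' : (-N).PosSemidef := hN
      exact IsSymm.add (by simpa using (isSymm_of_posSemidef hN').neg) hB.1
    · intro U hU
      have hU' : Uᵀ = U := hU
      obtain ⟨N, B, hUNB, hN, c, hc⟩ :=
        exists_decomposition_of_frobBounded hclosed hconv hne hb U
      -- Symmetrizing keeps both bounds, since they involve only pairings with symmetric matrices.
      refine ⟨(1 / 2 : ℝ) • (N + Nᵀ), ?_, (1 / 2 : ℝ) • (B + Bᵀ), ⟨isSymm_symmetrize B, ?_⟩, ?_⟩
      · refine posSemidef_iff_frobInner.2 ⟨(isSymm_symmetrize N).neg, fun u => ?_⟩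
        have hu := posSemidef_vecMulVec u
        rw [frobInner_neg_left, frobInner_comm, frobInner_symmetrize (isSymm_of_posSemidef hu)]
        linarith [hN _ hu]
      · refine lt_of_le_of_lt (iSup₂_le fun W hW => EReal.coe_le_coe_iff.2 ?_)
          (EReal.coe_lt_top c)
        rw [frobInner_symmetrize (hsymm hW)]
        exact hc W hW
      · have : U = (1 / 2 : ℝ) • (U + Uᵀ) := by
          rw [hU', ← two_smul ℝ U, smul_smul]
          norm_num
        change (1 / 2 : ℝ) • (N + Nᵀ) + (1 / 2 : ℝ) • (B + Bᵀ) = U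
        rw [this, ← smul_add, hUNB, transpose_add]
        congr 1
        abel
  · intro h
    -- Splitting 1 = N + B gives tr W = ⟨W, N⟩ + ⟨W, B⟩ ≤ σ_V(B) on V ∩ S₊, and the trace dominates
    -- the norm there.
    obtain ⟨N, hN, B, ⟨-, hB⟩, hNB⟩ : (1 : Matrix (Fin n) (Fin n) ℝ) ∈
        nsdCone n + barrierCone V := by
      rw [h]
      exact isSymm_one
    obtain ⟨c, hBc, -⟩ := EReal.lt_iff_exists_real_btwn.1 hB
    refine ⟨c, fun W hW => (frobNorm_le_trace hW.2).trans ?_⟩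
    have hN' : (-N).PosSemidef := hN
    have h1 := frobInner_nonneg_of_posSemidef hW.2 hN'
    have h2 : (frobInner W B : EReal) ≤ c :=
      (le_iSup₂ (f := fun W (_ : W ∈ V) => (frobInner W B : EReal)) W hW.1).trans hBc.le
    rw [frobInner_neg_right] at h1
    rw [← hNB]
    change frobInner W (N + B) ≤ c
    rw [frobInner_add_right]
    linarith [EReal.coe_le_coe_iff.1 h2]

end VGF

theorem mainTheorem6 (n m : ℕ) (V : Set (Matrix (Fin n) (Fin n) ℝ))
    (hVsymm : V ⊆ VGF.symMat n) (hVclosed : IsClosed V) (hVconvex : Convex ℝ V) :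
    -- the two forms of the second assumption agree
    ((V ∩ VGF.psdCone n).Nonempty →
      (VGF.FrobBounded (V ∩ VGF.psdCone n) ↔
        VGF.nsdCone n + VGF.barrierCone V = VGF.symMat n)) ∧
    -- the conjugate and the squared gauges
    (((V ∩ VGF.pdCone n).Nonempty ∨
        ((V ∩ VGF.psdCone n).Nonempty ∧ VGF.FrobBounded (V ∩ VGF.psdCone n))) →
      (∀ (l : ℕ) (X : Matrix (Fin n) (Fin m) ℝ),
        VGF.conjFn (VGF.gramFn m V) X =
          ⨅ W ∈ VGF.symMat n,
            (VGF.supportFnProd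
              (VGF.setOmega (0 : Matrix (Fin l) (Fin n) ℝ) (0 : Matrix (Fin l) (Fin m) ℝ)) X W +
              VGF.indicatorFn V W)) ∧
      (∀ X : Matrix (Fin n) (Fin m) ℝ,
        VGF.conjFn (VGF.gramFn m V) X =
          ((1 / 2 : ℝ) : EReal) *
            ⨅ (W : Matrix (Fin n) (Fin n) ℝ)
              (_ : W ∈ V ∩ VGF.psdCone n ∧ VGF.rge X ≤ VGF.rge W),
              ((Matrix.trace (X.transpose * VGF.pinv W * X) : ℝ) : EReal)) ∧
      ((0 : Matrix (Fin n) (Fin n) ℝ) ∈ V →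
        (∀ Y : Matrix (Fin n) (Fin m) ℝ,
          VGF.gramFn m V Y =
            ((1 / 2 : ℝ) : EReal) * VGF.gaugeFn (VGF.polarSet (VGF.factorSet m V)) Y ^ 2) ∧
        (∀ X : Matrix (Fin n) (Fin m) ℝ,
          VGF.conjFn (VGF.gramFn m V) X =
            ((1 / 2 : ℝ) : EReal) * VGF.gaugeFn (VGF.factorSet m V) X ^ 2))) ∧
    -- finiteness
    ((V ∩ VGF.pdCone n).Nonempty →
      ∀ X : Matrix (Fin n) (Fin m) ℝ,
        VGF.conjFn (VGF.gramFn m V) X ≠ ⊤ ∧ VGF.conjFn (VGF.gramFn m V) X ≠ ⊥) ∧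
    ((V ∩ VGF.psdCone n).Nonempty ∧ VGF.FrobBounded (V ∩ VGF.psdCone n) →
      ∀ Y : Matrix (Fin n) (Fin m) ℝ,
        VGF.gramFn m V Y ≠ ⊤ ∧ VGF.gramFn m V Y ≠ ⊥) := by
  refine ⟨VGF.frobBounded_iff hVsymm hVclosed hVconvex, fun h => ⟨fun l X => ?_, fun X => ?_,
    fun h0 => ⟨VGF.gramFn_eq_gaugeFn h0, fun X => ?_⟩⟩, fun h X => ?_,
    fun h Y => VGF.gramFn_ne h.1 h.2 Y⟩
  · rw [VGF.conjFn_gramFn hVclosed hVconvex h, VGF.iInf_supportFnProd_setOmega l hVsymm]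
  · rw [VGF.conjFn_gramFn hVclosed hVconvex h, VGF.iInf_iSup_coupling]
  · rw [VGF.conjFn_gramFn hVclosed hVconvex h, VGF.iInf_iSup_coupling_eq_gaugeFn]
  · rw [VGF.conjFn_gramFn hVclosed hVconvex (Or.inl h)]
    exact VGF.iInf_iSup_coupling_ne h X
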